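/- Let $M$ be a smooth manifold of dimension $n\ge 4$ and let $g(t)$, $t\in J$, be a Ricci flow on $M$, where $J\subseteq\mathbb{R}$ is a nondegenerate interval: the Riemannian metrics $g(t)$ depend smoothly on space and time and satisfy $\partial_t g_{ij}=-2R_{ij}$, where $R_{ij}$ is the Ricci tensor of $g(t)$ (with one-sided time derivatives at any end point belonging to $J$). Let $R_{ijkl}$ be the Riemann tensor, with the sign convention that $R_{ijkl}v^iw^jv^kw^l>0$ for linearly independent $v,w$ on round spheres, let $R_{ik}=g^{jl}R_{ijkl}$ and $R=g^{ik}R_{ik}$, and suppose that the Weyl tensor $$W_{ijkl}=R_{ijkl}+\frac{R}{(n-1)(n-2)}\,(g_{ik}g_{jl}-g_{il}g_{jk})-\frac{1}{n-2}\,(R_{ik}g_{jl}-R_{il}g_{jk}+R_{jl}g_{ik}-R_{jk}g_{il})$$ of $g(t)$ vanishes identically on $M$ for every $t\in J$. Then, for every $t\in J$ and at every point $p\in M$, either the Ricci tensor of $g(t)$ is proportional to the metric, that is, $\mathrm{Ric}=\lambda g$ at $p$ for some $\lambda\in\mathbb{R}$, or the Ricci tensor (viewed through $g(t)$ as an endomorphism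 of $T_pM$) has an eigenvalue of multiplicity exactly $n-1$ and another, different, eigenvalue of multiplicity exactly $1$. -/

import Mathlib

open scoped Manifold ContDiff

/-- A smooth Riemannian metric on the `n`-dimensional smooth manifold `M` (without boundary):
Mathlib's smoothly varying inner products on the fibres of the tangent bundle. -/
abbrev SmoothMetric (n : ℕ) (M : Type*) [TopologicalSpace M]
    [ChartedSpace (EuclideanSpace ℝ (Fin n)) M] [IsManifold (𝓡 n) ∞ M] :=
  Bundle.ContMDiffRiemannianMetric (𝓡 n) ∞ (EuclideanSpace ℝ (Fin n))
    (fun p : M => TangentSpace (𝓡 n) p)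

noncomputable section

/-! ### Curvature of a metric given by its components in local coordinates

Throughout, `G x` is the matrix `(g_ij(x))` of the components of a metric at the point with
coordinates `x`. -/

namespace LocalCoord

variable {n : ℕ}

/-- The partial derivative `∂f/∂x^i` at `x`. -/
def pderiv (i : Fin n) (f : EuclideanSpace ℝ (Fin n) → ℝ) (x : EuclideanSpace ℝ (Fin n)) : ℝ :=
  fderiv ℝ f x (EuclideanSpace.single i 1)

/-- Christoffel symbols of the Levi-Civita connection:
`Γ^k_ij = (1/2) g^{kl} (∂_i g_jl + ∂_j g_il - ∂_l g_ij)`. -/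
def christoffel (G : EuclideanSpace ℝ (Fin n) → Matrix (Fin n) (Fin n) ℝ) (k i j : Fin n)
    (x : EuclideanSpace ℝ (Fin n)) : ℝ :=
  (1 / 2) * ∑ l, (G x)⁻¹ k l *
    (pderiv i (fun y => G y j l) x + pderiv j (fun y => G y i l) x
      - pderiv l (fun y => G y i j) x)

/-- The components `R^l_ijk` of `Riem(X,Y)Z = ∇_Y ∇_X Z - ∇_X ∇_Y Z + ∇_[X,Y] Z`, that is
`Riem(∂_i, ∂_j) ∂_k = R^l_ijk ∂_l`, hence
`R^l_ijk = ∂_j Γ^l_ik - ∂_i Γ^l_jk + Γ^m_ik Γ^l_jm - Γ^m_jk Γ^l_im`. -/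
def riemUp (G : EuclideanSpace ℝ (Fin n) → Matrix (Fin n) (Fin n) ℝ) (l i j k : Fin n)
    (x : EuclideanSpace ℝ (Fin n)) : ℝ :=
  pderiv j (christoffel G l i k) x - pderiv i (christoffel G l j k) x
    + ∑ m, (christoffel G m i k x * christoffel G l j m x
      - christoffel G m j k x * christoffel G l i m x)

/-- The `(4,0)` Riemann tensor `R_ijkl = g_lm R^m_ijk`, for which `R_ijij > 0` on spheres. -/
def riem (G : EuclideanSpace ℝ (Fin n) → Matrix (Fin n) (Fin n) ℝ) (i j k l : Fin n)
    (x : EuclideanSpace ℝ (Fin n)) : ℝ :=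
  ∑ m, G x l m * riemUp G m i j k x

/-- The Ricci tensor `R_ik = g^{jl} R_ijkl`. -/
def ricci (G : EuclideanSpace ℝ (Fin n) → Matrix (Fin n) (Fin n) ℝ) (i k : Fin n)
    (x : EuclideanSpace ℝ (Fin n)) : ℝ :=
  ∑ j, ∑ l, (G x)⁻¹ j l * riem G i j k l x

/-- The scalar curvature `R = g^{ik} R_ik`. -/
def scalar (G : EuclideanSpace ℝ (Fin n) → Matrix (Fin n) (Fin n) ℝ)
    (x : EuclideanSpace ℝ (Fin n)) : ℝ :=
  ∑ i, ∑ k, (G x)⁻¹ i k * ricci G i k x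

/-- The Weyl tensor (in dimension `n ≥ 3`):
`W_ijkl = R_ijkl + R / ((n-1)(n-2)) (g_ik g_jl - g_il g_jk)
  - 1 / (n-2) (R_ik g_jl - R_il g_jk + R_jl g_ik - R_jk g_il)`. -/
def weyl (G : EuclideanSpace ℝ (Fin n) → Matrix (Fin n) (Fin n) ℝ) (i j k l : Fin n)
    (x : EuclideanSpace ℝ (Fin n)) : ℝ :=
  riem G i j k l x
    + scalar G x / (((n : ℝ) - 1) * ((n : ℝ) - 2)) * (G x i k * G x j l - G x i l * G x j k)
    - 1 / ((n : ℝ) - 2) * (ricci G i k x * G x j l - ricci G i l x * G x j k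
      + ricci G j l x * G x i k - ricci G j k x * G x i l)

/-- The Ricci endomorphism `v^k ↦ g^{ij} R_jk v^k` of the tangent space at the point with
coordinates `x`, written in the coordinate basis. Its eigenvalues are the eigenvalues of the
Ricci tensor with respect to the metric. -/
def ricciEndo (G : EuclideanSpace ℝ (Fin n) → Matrix (Fin n) (Fin n) ℝ)
    (x : EuclideanSpace ℝ (Fin n)) : Module.End ℝ (Fin n → ℝ) :=
  Matrix.toLin' ((G x)⁻¹ * Matrix.of fun j k => ricci G j k x)

end LocalCoord

section Manifold

variable {n : ℕ} {M : Type*} [TopologicalSpace M] [ChartedSpace (EuclideanSpace ℝ (Fin n)) M]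
  [IsManifold (𝓡 n) ∞ M]

/-- The coordinate vector field `∂/∂x^i` of the chart `φ` at the point `φ⁻¹(x)`. -/
def coordVector (φ : OpenPartialHomeomorph M (EuclideanSpace ℝ (Fin n)))
    (x : EuclideanSpace ℝ (Fin n)) (i : Fin n) : TangentSpace (𝓡 n) (φ.symm x) :=
  mfderiv (𝓡 n) (𝓡 n) φ.symm x (EuclideanSpace.single i (1 : ℝ) : EuclideanSpace ℝ (Fin n))

/-- The components `g_ij = g(∂/∂x^i, ∂/∂x^j)` of the metric `g` in the chart `φ`, as functions
of the coordinates `x ∈ φ.target`. -/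
def metricCoord (g : SmoothMetric n M)
    (φ : OpenPartialHomeomorph M (EuclideanSpace ℝ (Fin n)))
    (x : EuclideanSpace ℝ (Fin n)) : Matrix (Fin n) (Fin n) ℝ :=
  Matrix.of fun i j => g.inner (φ.symm x) (coordVector φ x i) (coordVector φ x j)

/-- `g(t)`, for `t` in the (nondegenerate) time interval `J`, is a Ricci flow on `M`: it is smooth
in space and time, and `∂g_ij/∂t = -2 R_ij` in every smooth chart of `M` (with a one-sided time
derivative at an end point of `J` that belongs to `J`). -/
structure IsRicciFlow (J : Set ℝ) (g : ℝ → SmoothMetric n M) : Prop where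
  ordConnected : J.OrdConnected
  nontrivial : J.Nontrivial
  smooth : ∀ φ ∈ IsManifold.maximalAtlas (𝓡 n) ∞ M, ∀ i j : Fin n,
    ContDiffOn ℝ ∞ (fun z : ℝ × EuclideanSpace ℝ (Fin n) => metricCoord (g z.1) φ z.2 i j)
      (J ×ˢ φ.target)
  evolution : ∀ φ ∈ IsManifold.maximalAtlas (𝓡 n) ∞ M, ∀ i j : Fin n,
    ∀ t ∈ J, ∀ x ∈ φ.target,
      HasDerivWithinAt (fun s => metricCoord (g s) φ x i j)
        (-2 * LocalCoord.ricci (metricCoord (g t) φ) i j x) J t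

/-- The Weyl tensor of `g` vanishes identically: all its components are zero at all points of
all charts. -/
def WeylVanishes (g : SmoothMetric n M) : Prop :=
  ∀ φ ∈ IsManifold.maximalAtlas (𝓡 n) ∞ M, ∀ x ∈ φ.target, ∀ i j k l : Fin n,
    LocalCoord.weyl (metricCoord g φ) i j k l x = 0

end Manifold

end

/-!
The proof works in a single chart and never changes coordinates. Let `R` be the algebra of smooth
functions on `J × U`, where `U` is the coordinate domain, with its commuting derivations `D i`
(space) and `τ` (time). The components `g`, the Christoffel symbols `Γ i` (a matrix for each
direction `i`), and the curvature `F i j` are matrices over `R`. Let `A` be the Schouten tensor;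
`W = 0` says that the Riemann tensor is the Kulkarni-Nomizu product `A ∧ g`, the flow equation says
`τ g = -2 ((n - 2) A + s g)`.

* The second Bianchi identity is an identity between noncommutative polynomials in `Γ i` and `D i`
  (`curvature_bianchi`). Inserting `A ∧ g` and contracting twice shows that for `n ≥ 4` the Cotton
  tensor vanishes (`cotton_eq_zero`), so `∇A` is totally symmetric.
* Consequently the time derivative of the Christoffel symbols is `-(n - 2) ∇A` up to terms that
  contain the metric (`lower_derive_christoffel`). Differentiating once more, the second derivatives
  of `A` enter `τ Riem` only through a commutator, which the Ricci identity turns into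
  curvature times `A`.
* On the other hand `τ Riem = τ (A ∧ g)`. Comparing the two expressions gives `A ∧ A = B ∧ g` for
  some `B` (`exists_kn_eq`), hence the same for the Ricci tensor (`exists_ricci_kn`).
* In a `g`-orthonormal basis of eigenvectors of the Ricci tensor, with eigenvalues `d i`, this says
  `d i * d j = B i i + B j j` for `i ≠ j`. Therefore `(d i - d l) * (d j - d k) = 0` for distinct
  `i`, `j`, `k`, `l`, which leaves at most one eigenvalue different from all the others
  (`eigenvalue_dichotomy`).
-/

open Matrix

/-! ### Connections and curvature over an algebra with derivations -/

namespace LeviCivita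

variable {ι R : Type*} [CommRing R] [Algebra ℝ R]

/-- The entrywise derivative of a matrix of functions. -/
def dm (d : Derivation ℝ R R) (M : Matrix ι ι R) : Matrix ι ι R := M.map d

@[simp] lemma dm_apply (d : Derivation ℝ R R) (M : Matrix ι ι R) (i j : ι) :
    dm d M i j = d (M i j) := rfl

lemma dm_add (d : Derivation ℝ R R) (M N : Matrix ι ι R) : dm d (M + N) = dm d M + dm d N := by
  ext; simp

lemma dm_sub (d : Derivation ℝ R R) (M N : Matrix ι ι R) : dm d (M - N) = dm d M - dm d N := by
  ext; simp

lemma dm_transpose (d : Derivation ℝ R R) (M : Matrix ι ι R) : dm d Mᵀ = (dm d M)ᵀ := rfl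

lemma dm_comm {d e : Derivation ℝ R R} (h : ∀ f, d (e f) = e (d f)) (M : Matrix ι ι R) :
    dm d (dm e M) = dm e (dm d M) := by
  ext; simp [h]

variable [Fintype ι]

lemma dm_mul (d : Derivation ℝ R R) (M N : Matrix ι ι R) :
    dm d (M * N) = dm d M * N + M * dm d N := by
  ext i j
  simp only [dm_apply, Matrix.mul_apply, Matrix.add_apply, map_sum, Derivation.leibniz,
    smul_eq_mul, ← Finset.sum_add_distrib]
  exact Finset.sum_congr rfl fun k _ => by ring

/-- The covariant derivative of a `(0,2)`-tensor in one fixed direction `d`, where `Γ` is the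
connection matrix of that direction, `Γ l k = Γ^l_dk`. -/
def covDeriv (d : Derivation ℝ R R) (Γ Y : Matrix ι ι R) : Matrix ι ι R := dm d Y - Γᵀ * Y - Y * Γ

/-- The covariant derivative of a covector in one fixed direction `d` with connection matrix `Γ`. -/
def covVec (d : Derivation ℝ R R) (Γ : Matrix ι ι R) (u : ι → R) : ι → R :=
  fun k => d (u k) - ∑ p, Γ p k * u p

/-- The curvature matrices of the connection `Γ`, where `Γ i l k` stands for `Γ^l_ik`: the entry
`(l, k)` of `curvature D Γ i j` is `R^l_ijk`. -/
def curvature (D : ι → Derivation ℝ R R) (Γ : ι → Matrix ι ι R) (i j : ι) : Matrix ι ι R :=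
  dm (D j) (Γ i) - dm (D i) (Γ j) + Γ j * Γ i - Γ i * Γ j

/-- The Kulkarni-Nomizu product of two symmetric `(0,2)`-tensors. -/
def kn (A B : Matrix ι ι R) (i j k l : ι) : R :=
  A i k * B j l + A j l * B i k - A i l * B j k - A j k * B i l

lemma covDeriv_add (d : Derivation ℝ R R) (Γ X Y : Matrix ι ι R) :
    covDeriv d Γ (X + Y) = covDeriv d Γ X + covDeriv d Γ Y := by
  simp only [covDeriv, dm_add]; noncomm_ring

lemma covDeriv_sub (d : Derivation ℝ R R) (Γ X Y : Matrix ι ι R) :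
    covDeriv d Γ (X - Y) = covDeriv d Γ X - covDeriv d Γ Y := by
  simp only [covDeriv, dm_sub]; noncomm_ring

lemma covDeriv_smul (d : Derivation ℝ R R) (Γ X : Matrix ι ι R) (s : R) :
    covDeriv d Γ (s • X) = d s • X + s • covDeriv d Γ X := by
  ext i j
  simp only [covDeriv, Matrix.sub_apply, dm_apply, Matrix.smul_apply, Matrix.add_apply,
    smul_eq_mul, Derivation.leibniz, Matrix.mul_smul, Matrix.smul_mul]
  ring

lemma covDeriv_vecMulVec (d : Derivation ℝ R R) (Γ : Matrix ι ι R) (u v : ι → R) :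
    covDeriv d Γ (vecMulVec u v) = vecMulVec (covVec d Γ u) v + vecMulVec u (covVec d Γ v) := by
  ext l k
  simp only [covDeriv, covVec, Matrix.sub_apply, dm_apply, Matrix.add_apply, vecMulVec_apply,
    Derivation.leibniz, smul_eq_mul, Matrix.mul_apply, Matrix.transpose_apply, sub_mul, mul_sub,
    Finset.sum_mul, Finset.mul_sum]
  have h1 : ∑ x, Γ x l * (u x * v k) = ∑ x, Γ x l * u x * v k :=
    Finset.sum_congr rfl fun _ _ => by ring
  have h2 : ∑ x, u l * v x * Γ x k = ∑ x, u l * (Γ x k * v x) :=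
    Finset.sum_congr rfl fun _ _ => by ring
  rw [h1, h2]; ring

section Connection

variable {D : ι → Derivation ℝ R R} {Γ : ι → Matrix ι ι R} {g : Matrix ι ι R}

/-- The second Bianchi identity. It needs neither a metric nor a torsion-free connection. -/
theorem curvature_bianchi (hD : ∀ i j f, D i (D j f) = D j (D i f)) (m i j : ι) :
    (dm (D m) (curvature D Γ i j) + Γ m * curvature D Γ i j - curvature D Γ i j * Γ m)
    + (dm (D i) (curvature D Γ j m) + Γ i * curvature D Γ j m - curvature D Γ j m * Γ i)
    + (dm (D j) (curvature D Γ m i) + Γ j * curvature D Γ m i - curvature D Γ m i * Γ j) = 0 := by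
  have h1 := dm_comm (hD m j) (Γ i)
  have h2 := dm_comm (hD m i) (Γ j)
  have h3 := dm_comm (hD i j) (Γ m)
  simp only [curvature, dm_add, dm_sub, dm_mul, h1, h2, h3]
  noncomm_ring

/-- Lowering an index commutes with covariant differentiation. -/
lemma covDeriv_lower {d : Derivation ℝ R R} {Γ : Matrix ι ι R}
    (hg : dm d g = Γᵀ * g + g * Γ) (X : Matrix ι ι R) :
    covDeriv d Γ (g * X) = g * (dm d X + Γ * X - X * Γ) := by
  simp only [covDeriv, dm_mul, hg]; noncomm_ring

lemma covDeriv_metric {d : Derivation ℝ R R} {Γ : Matrix ι ι R}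
    (hg : dm d g = Γᵀ * g + g * Γ) : covDeriv d Γ g = 0 := by
  simp only [covDeriv, hg]; noncomm_ring

theorem lowered_bianchi (hD : ∀ i j f, D i (D j f) = D j (D i f))
    (hg : ∀ i, dm (D i) g = (Γ i)ᵀ * g + g * Γ i) (m i j : ι) :
    covDeriv (D m) (Γ m) (g * curvature D Γ i j) + covDeriv (D i) (Γ i) (g * curvature D Γ j m)
      + covDeriv (D j) (Γ j) (g * curvature D Γ m i) = 0 := by
  rw [covDeriv_lower (hg m), covDeriv_lower (hg i), covDeriv_lower (hg j), ← mul_add, ← mul_add,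
    curvature_bianchi hD, mul_zero]

/-- The Ricci identity for a `(0,2)`-tensor. In the iterated derivative the connection is not
applied to the index of the first derivative; for a torsion-free connection that term drops out
of the commutator. -/
theorem ricci_identity (hD : ∀ i j f, D i (D j f) = D j (D i f)) (A : Matrix ι ι R) (i j : ι) :
    covDeriv (D j) (Γ j) (covDeriv (D i) (Γ i) A) - covDeriv (D i) (Γ i) (covDeriv (D j) (Γ j) A)
      = -((curvature D Γ i j)ᵀ * A + A * curvature D Γ i j) := by
  have h1 := dm_comm (hD i j) A
  simp only [covDeriv, curvature, dm_sub, dm_mul, h1, dm_transpose, Matrix.transpose_add,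
    Matrix.transpose_sub, Matrix.transpose_mul]
  noncomm_ring

/-- The variation of the curvature is the exterior covariant derivative of the variation of the
connection. -/
theorem derive_curvature {τ : Derivation ℝ R R} (hτ : ∀ i f, τ (D i f) = D i (τ f)) (i j : ι) :
    dm τ (curvature D Γ i j) = (dm (D j) (dm τ (Γ i)) + Γ j * dm τ (Γ i) - dm τ (Γ i) * Γ j)
      - (dm (D i) (dm τ (Γ j)) + Γ i * dm τ (Γ j) - dm τ (Γ j) * Γ i) := by
  have h1 := dm_comm (hτ j) (Γ i)
  have h2 := dm_comm (hτ i) (Γ j)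
  simp only [curvature, dm_add, dm_sub, dm_mul, h1, h2]
  noncomm_ring

lemma covVec_metric (hg : ∀ i, dm (D i) g = (Γ i)ᵀ * g + g * Γ i) (m i k : ι) :
    covVec (D m) (Γ m) (g i) k = ∑ p, Γ m p i * g p k - ∑ p, Γ m p k * g i p
      + ∑ p, g i p * Γ m p k := by
  have := congrFun (congrFun (hg m) i) k
  simp only [dm_apply, Matrix.add_apply, Matrix.mul_apply, Matrix.transpose_apply] at this
  simp only [covVec, this]; ring

/-- Each row of the metric is a covector; its covariant derivative, `Γ^p_mi g_pk`, is symmetric in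
the direction and the row index. -/
lemma covVec_metric_symm (hΓ : ∀ i k l, Γ i l k = Γ k l i)
    (hg : ∀ i, dm (D i) g = (Γ i)ᵀ * g + g * Γ i) (m i k : ι) :
    covVec (D m) (Γ m) (g i) k = covVec (D i) (Γ i) (g m) k := by
  rw [covVec_metric hg, covVec_metric hg]
  have h1 : ∀ m i k, ∑ p, Γ m p k * g i p = ∑ p, g i p * Γ m p k :=
    fun m i k => Finset.sum_congr rfl fun _ _ => mul_comm _ _
  have h2 : ∑ p, Γ m p i * g p k = ∑ p, Γ i p m * g p k :=
    Finset.sum_congr rfl fun p _ => by rw [hΓ]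
  rw [h1, h1, h2]; ring

/-- The skew part `∇_m A_ik - ∇_i A_mk` of the covariant derivative of `A`. When `A` is the Schouten
tensor this is the Cotton tensor. -/
def cotton (D : ι → Derivation ℝ R R) (Γ : ι → Matrix ι ι R) (A : Matrix ι ι R) (m i k : ι) : R :=
  covVec (D m) (Γ m) (A i) k - covVec (D i) (Γ i) (A m) k

lemma cotton_eq (hΓ : ∀ i k l, Γ i l k = Γ k l i) {A : Matrix ι ι R} (m i k : ι) :
    cotton D Γ A m i k = covDeriv (D m) (Γ m) A i k - covDeriv (D i) (Γ i) A m k := by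
  simp only [cotton, covVec, covDeriv, Matrix.sub_apply, dm_apply, Matrix.mul_apply,
    Matrix.transpose_apply]
  have h1 : ∀ m i k, ∑ p, Γ m p k * A i p = ∑ p, A i p * Γ m p k :=
    fun m i k => Finset.sum_congr rfl fun _ _ => mul_comm _ _
  have h2 : ∑ p, Γ m p i * A p k = ∑ p, Γ i p m * A p k :=
    Finset.sum_congr rfl fun p _ => by rw [hΓ]
  rw [h1, h1, h2]; ring

/-- The second Bianchi identity for a Riemann tensor of the form `A ∧ g`. -/
theorem cotton_identity (hD : ∀ i j f, D i (D j f) = D j (D i f))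
    (hΓ : ∀ i k l, Γ i l k = Γ k l i) (hg : ∀ i, dm (D i) g = (Γ i)ᵀ * g + g * Γ i)
    {A : Matrix ι ι R} (hW : ∀ i j k l, (g * curvature D Γ i j) l k = kn A g i j k l)
    (m i j k l : ι) :
    cotton D Γ A m i k * g j l + cotton D Γ A i j k * g m l + cotton D Γ A j m k * g i l
      - cotton D Γ A m i l * g j k - cotton D Γ A i j l * g m k
      - cotton D Γ A j m l * g i k = 0 := by
  -- For fixed `i`, `j`, a Kulkarni-Nomizu product is a sum of outer products of rows.
  have hF : ∀ i j, g * curvature D Γ i j = vecMulVec (g j) (A i) + vecMulVec (A j) (g i)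
      - vecMulVec (A i) (g j) - vecMulVec (g i) (A j) := by
    intro i j; ext l k
    simp only [hW, kn, Matrix.sub_apply, Matrix.add_apply, vecMulVec_apply]; ring
  have hB := congrFun (congrFun (lowered_bianchi hD hg m i j) l) k
  have hs := covVec_metric_symm hΓ hg
  simp only [hF, covDeriv_add, covDeriv_sub, covDeriv_vecMulVec, Matrix.sub_apply,
    Matrix.add_apply, vecMulVec_apply, Matrix.zero_apply, hs i m, hs j i, hs m j] at hB
  simp only [cotton]
  linear_combination hB

lemma natCast_mul_eq_zero {k : ℕ} (hk : k ≠ 0) {x : R} (h : (k : R) * x = 0) : x = 0 := by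
  have h1 : (k : ℝ) • x = 0 := by rw [Algebra.smul_def, map_natCast, h]
  simpa [hk] using h1

/-- If `Riem = A ∧ g` in dimension at least four, then `∇A` is totally symmetric. -/
theorem cotton_eq_zero [DecidableEq ι] (hn : 4 ≤ Fintype.card ι)
    (hD : ∀ i j f, D i (D j f) = D j (D i f))
    (hΓ : ∀ i k l, Γ i l k = Γ k l i) (hg : ∀ i, dm (D i) g = (Γ i)ᵀ * g + g * Γ i)
    {H : Matrix ι ι R} (hH : g * H = 1) {A : Matrix ι ι R}
    (hW : ∀ i j k l, (g * curvature D Γ i j) l k = kn A g i j k l)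
    (m i k : ι) : cotton D Γ A m i k = 0 := by
  set C := cotton D Γ A with hC
  have hI := cotton_identity hD hΓ hg hW
  rw [← hC] at hI
  have hanti : ∀ m i k, C m i k = - C i m k := fun m i k => by simp [hC, cotton]
  have hgH : ∀ a b, ∑ l, g a l * H l b = if a = b then 1 else 0 := fun a b => by
    rw [← Matrix.mul_apply, hH, Matrix.one_apply]
  have hHg : ∀ a b, ∑ j, H a j * g j b = if a = b then 1 else 0 := fun a b => by
    rw [← Matrix.mul_apply, mul_eq_one_comm.mp hH, Matrix.one_apply]
  have hgg : ∑ j, ∑ l, g j l * H l j = (Fintype.card ι : R) := by simp [hgH]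
  have c1 : ∀ (x : ι → R) a, ∑ j, ∑ l, H l j * (x j * g a l) = x a := fun x a => by
    have : ∀ j, ∑ l, H l j * (x j * g a l) = x j * ∑ l, g a l * H l j := fun j => by
      rw [Finset.mul_sum]; exact Finset.sum_congr rfl fun _ _ => by ring
    simp [this, hgH]
  have c2 : ∀ (x : ι → R) a, ∑ j, ∑ l, H l j * (x l * g j a) = x a := fun x a => by
    rw [Finset.sum_comm]
    have : ∀ l, ∑ j, H l j * (x l * g j a) = x l * ∑ j, H l j * g j a := fun l => by
      rw [Finset.mul_sum]; exact Finset.sum_congr rfl fun _ _ => by ring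
    simp [this, hHg]
  have c3 : ∀ x : R, ∑ j, ∑ l, H l j * (x * g j l) = (Fintype.card ι : R) * x := fun x => by
    rw [← hgg, Finset.sum_mul]
    refine Finset.sum_congr rfl fun _ _ => ?_
    rw [Finset.sum_mul]; exact Finset.sum_congr rfl fun _ _ => by ring
  set c : ι → R := fun i => ∑ j, ∑ l, H l j * C i j l with hc
  have c4 : ∀ i (x : R), ∑ j, ∑ l, H l j * (C i j l * x) = c i * x := fun i x => by
    simp only [hc, Finset.sum_mul, mul_assoc]
  have hcon : ∀ X : ι → ι → R, (∀ j l, X j l = 0) → ∑ j, ∑ l, H l j * X j l = 0 :=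
    fun X hX => by simp [hX]
  -- The contraction of the Bianchi identity over `j` and `l`.
  have hone : ∀ m i k, ((Fintype.card ι : R) - 3) * C m i k - c i * g m k + c m * g i k = 0 := by
    intro m i k
    have := hcon _ fun j l => hI m i j k l
    simp only [hanti _ m, mul_add, mul_sub, Finset.sum_add_distrib, Finset.sum_sub_distrib,
      c3, c1 (fun j => C i j k), neg_mul, mul_neg, Finset.sum_neg_distrib,
      c1 (fun j => C m j k), c2 (fun l => C m i l), c4] at this
    linear_combination this
  -- A second contraction, over `i` and `k`, kills the trace `c` since `2 n - 4 ≠ 0`.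
  have hc0 : ∀ m, c m = 0 := by
    intro m
    have := hcon _ fun i k => hone m i k
    have c5 : ∑ i, ∑ k, H k i * (((Fintype.card ι : R) - 3) * C m i k)
        = ((Fintype.card ι : R) - 3) * c m := by
      simp only [hc, Finset.mul_sum]
      exact Finset.sum_congr rfl fun _ _ => Finset.sum_congr rfl fun _ _ => by ring
    simp only [mul_add, mul_sub (H _ _), Finset.sum_add_distrib, Finset.sum_sub_distrib, c5, c1,
      c3] at this
    refine natCast_mul_eq_zero (k := 2 * Fintype.card ι - 4) (by omega) ?_
    rw [Nat.cast_sub (by omega)]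
    push_cast
    linear_combination this
  refine natCast_mul_eq_zero (k := Fintype.card ι - 3) (by omega) ?_
  rw [Nat.cast_sub (by omega)]
  push_cast
  have := hone m i k
  rw [hc0, hc0] at this
  linear_combination this

/-! ### The Levi-Civita connection -/

section Christoffel

variable {H : Matrix ι ι R}

/-- The Christoffel symbols `Γ^l_ik` of the metric `g` with inverse `H`, as the entries `(l, k)` of
a matrix for each direction `i`. -/
noncomputable def christoffelMatrix (D : ι → Derivation ℝ R R) (g H : Matrix ι ι R) (i : ι) :
    Matrix ι ι R :=
  Matrix.of fun l k =>
    (1 / 2 : ℝ) • ∑ p, H l p * (D i (g k p) + D k (g i p) - D p (g i k))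

lemma christoffelMatrix_symm (hgs : gᵀ = g) (i k l : ι) :
    christoffelMatrix D g H i l k = christoffelMatrix D g H k l i := by
  have hgs' : ∀ i j, g i j = g j i := fun i j => congrFun (congrFun hgs j) i
  simp only [christoffelMatrix, Matrix.of_apply, hgs' i k, add_comm (D i _)]

lemma lower_christoffelMatrix [DecidableEq ι] (hH : g * H = 1) (i l k : ι) :
    (g * christoffelMatrix D g H i) l k
      = (1 / 2 : ℝ) • (D i (g k l) + D k (g i l) - D l (g i k)) := by
  have h : christoffelMatrix D g H i = (1 / 2 : ℝ) • (H * Matrix.of fun p k =>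
      D i (g k p) + D k (g i p) - D p (g i k)) := by
    ext l k
    simp only [christoffelMatrix, Matrix.of_apply, Matrix.smul_apply, Matrix.mul_apply]
  rw [h, mul_smul_comm, ← mul_assoc, hH, one_mul]
  rfl

/-- The Levi-Civita connection is metric. -/
theorem dm_metric_eq [DecidableEq ι] (hgs : gᵀ = g) (hH : g * H = 1) (i : ι) :
    dm (D i) g = (christoffelMatrix D g H i)ᵀ * g + g * christoffelMatrix D g H i := by
  have hgs' : ∀ i j, g i j = g j i := fun i j => congrFun (congrFun hgs j) i
  have h : (christoffelMatrix D g H i)ᵀ * g = (g * christoffelMatrix D g H i)ᵀ := by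
    rw [Matrix.transpose_mul, hgs]
  ext l k
  rw [h, Matrix.add_apply, Matrix.transpose_apply, lower_christoffelMatrix hH,
    lower_christoffelMatrix hH, ← smul_add, hgs' k l, hgs' i l, hgs' i k, dm_apply]
  have : D i (g l k) + D l (g k i) - D k (g l i) + (D i (g l k) + D k (g l i) - D l (g k i))
      = (2 : ℝ) • D i (g l k) := by rw [two_smul]; ring
  rw [this, smul_smul]; norm_num

end Christoffel

/-! ### Variation of the curvature along the flow -/

section Flow

variable {τ : Derivation ℝ R R} {H A : Matrix ι ι R}

/-- The time derivative of the equation `∇g = 0`. -/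
theorem covDeriv_derive_metric (hτ : ∀ i f, τ (D i f) = D i (τ f)) (hgs : gᵀ = g)
    (hg : ∀ i, dm (D i) g = (Γ i)ᵀ * g + g * Γ i) (i : ι) :
    covDeriv (D i) (Γ i) (dm τ g) = (g * dm τ (Γ i))ᵀ + g * dm τ (Γ i) := by
  have h1 := congrArg (dm τ) (hg i)
  rw [dm_comm (hτ i)] at h1
  simp only [covDeriv, h1, dm_add, dm_mul, dm_transpose, Matrix.transpose_mul, hgs]
  noncomm_ring

/-- The variation of the Christoffel symbols in terms of the variation of the metric. -/
theorem koszul (hτ : ∀ i f, τ (D i f) = D i (τ f)) (hgs : gᵀ = g)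
    (hΓ : ∀ i k l, Γ i l k = Γ k l i) (hg : ∀ i, dm (D i) g = (Γ i)ᵀ * g + g * Γ i) (i l k : ι) :
    2 * (g * dm τ (Γ i)) l k = covDeriv (D i) (Γ i) (dm τ g) k l
      + covDeriv (D k) (Γ k) (dm τ g) i l - covDeriv (D l) (Γ l) (dm τ g) i k := by
  have hs : ∀ i l k, (g * dm τ (Γ i)) l k = (g * dm τ (Γ k)) l i := fun i l k => by
    simp only [Matrix.mul_apply, dm_apply]
    exact Finset.sum_congr rfl fun p _ => by rw [hΓ i k p]
  simp only [covDeriv_derive_metric hτ hgs hg, Matrix.add_apply, Matrix.transpose_apply]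
  rw [hs k l i, hs k i l, hs l k i]
  ring

/-- Along `∂g/∂t = -2 (c A + s g)` with `∇A` totally symmetric, the variation of the Christoffel
symbols is `-c ∇A` up to terms built from `ds` and `g`. -/
theorem lower_derive_christoffel (hτ : ∀ i f, τ (D i f) = D i (τ f)) (hgs : gᵀ = g) (hA : Aᵀ = A)
    (hΓ : ∀ i k l, Γ i l k = Γ k l i) (hg : ∀ i, dm (D i) g = (Γ i)ᵀ * g + g * Γ i)
    (hC : ∀ m i k, cotton D Γ A m i k = 0) {c : ℝ} {s : R}
    (hflow : dm τ g = (-2 : R) • (algebraMap ℝ R c • A + s • g)) (i : ι) :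
    g * dm τ (Γ i) = (-algebraMap ℝ R c) • covDeriv (D i) (Γ i) A
      - (D i s • g + vecMulVec (g i) (fun k => D k s) - vecMulVec (fun k => D k s) (g i)) := by
  have hN : ∀ i k l, covDeriv (D i) (Γ i) A k l = covDeriv (D k) (Γ k) A i l := fun i k l => by
    have := hC i k l
    rwa [cotton_eq hΓ, sub_eq_zero] at this
  have hNs : ∀ i k l, covDeriv (D i) (Γ i) A k l = covDeriv (D i) (Γ i) A l k := fun i k l => by
    have : (covDeriv (D i) (Γ i) A)ᵀ = covDeriv (D i) (Γ i) A := by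
      simp only [covDeriv, Matrix.transpose_sub, Matrix.transpose_mul, hA, ← dm_transpose,
        Matrix.transpose_transpose]
      abel
    exact congrFun (congrFun this l) k
  have hgs' : ∀ i j, g i j = g j i := fun i j => congrFun (congrFun hgs j) i
  have hh : ∀ i k l, covDeriv (D i) (Γ i) (dm τ g) k l
      = -2 * (algebraMap ℝ R c * covDeriv (D i) (Γ i) A k l + D i s * g k l) := fun i k l => by
    have h2 : D i (-2 : R) = 0 := by
      have := (D i).map_algebraMap (-2); rwa [map_neg, map_ofNat] at this
    rw [hflow, covDeriv_smul, covDeriv_add, covDeriv_smul, covDeriv_smul,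
      covDeriv_metric (hg i), Derivation.map_algebraMap, h2]
    simp only [zero_smul, zero_add, smul_zero, add_zero, Matrix.smul_apply, Matrix.add_apply,
      smul_eq_mul, Matrix.zero_apply]
  ext l k
  have h := koszul hτ hgs hΓ hg i l k
  simp only [hh] at h
  rw [hN k i l, hN l i k, hNs i l k] at h
  rw [← sub_eq_zero]
  refine natCast_mul_eq_zero two_ne_zero ?_
  simp only [Matrix.sub_apply, Matrix.add_apply, Matrix.smul_apply, vecMulVec_apply, smul_eq_mul]
  rw [hNs i l k, hgs' l k]
  push_cast
  linear_combination h

theorem covDeriv_lower_derive_christoffel (hτ : ∀ i f, τ (D i f) = D i (τ f)) (hgs : gᵀ = g)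
    (hA : Aᵀ = A) (hΓ : ∀ i k l, Γ i l k = Γ k l i)
    (hg : ∀ i, dm (D i) g = (Γ i)ᵀ * g + g * Γ i)
    (hC : ∀ m i k, cotton D Γ A m i k = 0) {c : ℝ} {s : R}
    (hflow : dm τ g = (-2 : R) • (algebraMap ℝ R c • A + s • g)) (i j l k : ι) :
    covDeriv (D j) (Γ j) (g * dm τ (Γ i)) l k
      = -algebraMap ℝ R c * covDeriv (D j) (Γ j) (covDeriv (D i) (Γ i) A) l k
        - D j (D i s) * g l k
        - covVec (D j) (Γ j) (g i) l * D k s - g i l * covVec (D j) (Γ j) (fun k => D k s) k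
        + covVec (D j) (Γ j) (fun k => D k s) l * g i k + D l s * covVec (D j) (Γ j) (g i) k := by
  rw [lower_derive_christoffel hτ hgs hA hΓ hg hC hflow]
  simp only [covDeriv_add, covDeriv_sub, covDeriv_smul, covDeriv_vecMulVec, covDeriv_metric (hg j),
    Matrix.sub_apply, Matrix.add_apply, Matrix.smul_apply, vecMulVec_apply, smul_eq_mul,
    Matrix.zero_apply, map_neg, Derivation.map_algebraMap]
  ring

/-- The product of `A` with the curvature when `Riem = A ∧ g`; here `A * H * A` is the
square of `A`. -/
theorem mul_curvature [DecidableEq ι] (hgs : gᵀ = g) (hA : Aᵀ = A) (hH : g * H = 1)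
    (hW : ∀ i j k l, (g * curvature D Γ i j) l k = kn A g i j k l) (i j k l : ι) :
    (A * curvature D Γ i j) l k = A i k * A j l + (A * H * A) j l * g i k
      - A j k * A i l - (A * H * A) i l * g j k := by
  have hHg : H * g = 1 := mul_eq_one_comm.mp hH
  have hHs : Hᵀ = H := by
    have : Hᵀ * g = 1 := by rw [← hgs, ← Matrix.transpose_mul, hH, Matrix.transpose_one]
    calc Hᵀ = Hᵀ * (g * H) := by rw [hH, mul_one]
      _ = H := by rw [← mul_assoc, this, one_mul]
  have hQ : (A * H * A)ᵀ = A * H * A := by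
    simp only [Matrix.transpose_mul, hA, hHs, mul_assoc]
  have hAs : ∀ i j, A i j = A j i := fun i j => congrFun (congrFun hA j) i
  have hgs' : ∀ i j, g i j = g j i := fun i j => congrFun (congrFun hgs j) i
  have e1 : A * curvature D Γ i j = A * H * (g * curvature D Γ i j) := by
    rw [mul_assoc, ← mul_assoc H, hHg, one_mul]
  have c1 : ∀ a, ∑ p, (A * H) l p * g a p = A a l := fun a => by
    have := congrFun (congrFun (show A * H * g = A by rw [mul_assoc, hHg, mul_one]) l) a
    rw [Matrix.mul_apply] at this
    rw [hAs, ← this]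
    exact Finset.sum_congr rfl fun p _ => by rw [hgs']
  have c2 : ∀ a, ∑ p, (A * H) l p * A a p = (A * H * A) a l := fun a => by
    rw [← hQ, Matrix.transpose_apply, Matrix.mul_apply]
    exact Finset.sum_congr rfl fun p _ => by rw [hAs]
  have e2 : (A * curvature D Γ i j) l k = ∑ p, ((A * H) l p * g j p * A i k
      + (A * H) l p * A j p * g i k - (A * H) l p * A i p * g j k
      - (A * H) l p * g i p * A j k) := by
    rw [e1, Matrix.mul_apply]
    exact Finset.sum_congr rfl fun p _ => by rw [hW, kn]; ring
  rw [e2]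
  simp only [Finset.sum_add_distrib, Finset.sum_sub_distrib, ← Finset.sum_mul, c1, c2]
  ring

/-- If `Riem = A ∧ g` is preserved by the flow `∂g/∂t = -2 (c A + s g)` in dimension at least four,
then `A ∧ A` is a Kulkarni-Nomizu multiple of the metric: the two ways to compute the time
derivative of the Riemann tensor differ by `A ∧ A` modulo such multiples. -/
theorem exists_kn_eq [DecidableEq ι] (hn : 4 ≤ Fintype.card ι)
    (hD : ∀ i j f, D i (D j f) = D j (D i f)) (hτ : ∀ i f, τ (D i f) = D i (τ f))
    (hgs : gᵀ = g) (hA : Aᵀ = A) (hΓ : ∀ i k l, Γ i l k = Γ k l i)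
    (hg : ∀ i, dm (D i) g = (Γ i)ᵀ * g + g * Γ i) (hH : g * H = 1)
    (hW : ∀ i j k l, (g * curvature D Γ i j) l k = kn A g i j k l) {c : ℝ} {s : R}
    (hflow : dm τ g = (-2 : R) • (algebraMap ℝ R c • A + s • g)) :
    ∃ B : Matrix ι ι R, ∀ i j k l,
      2 * algebraMap ℝ R c * (A i k * A j l - A i l * A j k) = kn B g i j k l := by
  have hC := cotton_eq_zero hn hD hΓ hg hH hW
  -- The time derivative of `A`, the square of `A`, and the Hessian of `s`.
  refine ⟨dm τ A + algebraMap ℝ R c • (A * H * A)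
    - Matrix.of fun j k => covVec (D j) (Γ j) (fun k => D k s) k, fun i j k l => ?_⟩
  have hAs : ∀ i j, A i j = A j i := fun i j => congrFun (congrFun hA j) i
  have hgs' : ∀ i j, g i j = g j i := fun i j => congrFun (congrFun hgs j) i
  have hd : ∀ i j, dm τ g i j = -2 * (algebraMap ℝ R c * A i j + s * g i j) := fun i j => by
    rw [hflow]; rfl
  have h1 : τ (kn A g i j k l) = (dm τ g * curvature D Γ i j) l k
      + (g * dm τ (curvature D Γ i j)) l k := by
    rw [← hW, ← dm_apply, dm_mul, Matrix.add_apply]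
  have h2 : (dm τ g * curvature D Γ i j) l k = -2 * (algebraMap ℝ R c
      * (A * curvature D Γ i j) l k + s * kn A g i j k l) := by
    rw [hflow, ← hW]
    simp only [Matrix.smul_mul, Matrix.add_mul, Matrix.smul_apply, Matrix.add_apply, smul_eq_mul]
  have h3 : (g * dm τ (curvature D Γ i j)) l k = covDeriv (D j) (Γ j) (g * dm τ (Γ i)) l k
      - covDeriv (D i) (Γ i) (g * dm τ (Γ j)) l k := by
    rw [derive_curvature hτ, mul_sub, ← covDeriv_lower (hg j), ← covDeriv_lower (hg i),
      Matrix.sub_apply]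
  have h4 := congrFun (congrFun (ricci_identity (Γ := Γ) hD A i j) l) k
  have hFA : ((curvature D Γ i j)ᵀ * A) l k = (A * curvature D Γ i j) k l := by
    rw [← Matrix.transpose_apply (A * _), Matrix.transpose_mul, hA]
  simp only [Matrix.sub_apply, Matrix.neg_apply, Matrix.add_apply, hFA,
    mul_curvature hgs hA hH hW] at h4
  have hcv := covDeriv_lower_derive_christoffel hτ hgs hA hΓ hg hC hflow
  rw [hcv, hcv, hD j i s, covVec_metric_symm hΓ hg j i, covVec_metric_symm hΓ hg j i] at h3
  rw [h2, h3, mul_curvature hgs hA hH hW] at h1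
  simp only [kn, map_add, map_sub, Derivation.leibniz, smul_eq_mul, ← dm_apply, hd] at h1
  simp only [dm_apply] at h1
  simp only [kn, Matrix.sub_apply, Matrix.add_apply, Matrix.smul_apply, smul_eq_mul, dm_apply,
    Matrix.of_apply]
  rw [hAs j k, hAs i k] at h1 h4 ⊢
  linear_combination algebraMap ℝ R c * h4 - h1

end Flow

end Connection

end LeviCivita

/-! ### The algebra of smooth functions on a set -/

section SmoothFunctions

variable {E : Type*} [NormedAddCommGroup E] [NormedSpace ℝ E] {S : Set E}

/-- The algebra of real functions on `S` that are restrictions of functions smooth on `S` in the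
sense of `ContDiffOn`. Functions that agree on `S` are identified, so that the derivatives within
`S` are derivations. -/
noncomputable def smoothFunctions (S : Set E) : Subalgebra ℝ (S → ℝ) where
  carrier := {f | ∃ F : E → ℝ, ContDiffOn ℝ ∞ F S ∧ ∀ z : S, F z = f z}
  mul_mem' := by
    rintro _ _ ⟨F, hF, hf⟩ ⟨G, hG, hg⟩
    exact ⟨fun z => F z * G z, hF.mul hG, fun z => by simp [hf, hg]⟩
  add_mem' := by
    rintro _ _ ⟨F, hF, hf⟩ ⟨G, hG, hg⟩
    exact ⟨fun z => F z + G z, hF.add hG, fun z => by simp [hf, hg]⟩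
  algebraMap_mem' r := ⟨fun _ => r, contDiffOn_const, fun _ => rfl⟩

namespace smoothFunctions

/-- The restriction to `S` of a function that is smooth on `S`. -/
noncomputable def mk (F : E → ℝ) (hF : ContDiffOn ℝ ∞ F S) : smoothFunctions S :=
  ⟨fun z => F z, F, hF, fun _ => rfl⟩

/-- Evaluation at a point of `S`. -/
noncomputable def eval (z : S) : smoothFunctions S →ₐ[ℝ] ℝ :=
  (Pi.evalAlgHom ℝ (fun _ : S => ℝ) z).comp (smoothFunctions S).val

lemma ext_eval {f f' : smoothFunctions S} (h : ∀ z, eval z f = eval z f') : f = f' :=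
  Subtype.ext (funext h)

@[simp] lemma eval_mk (F : E → ℝ) (hF : ContDiffOn ℝ ∞ F S) (z : S) : eval z (mk F hF) = F z := rfl

/-- A function on the whole space with the given restriction to `S`; its values off `S` are
arbitrary. -/
noncomputable def extension (f : smoothFunctions S) : E → ℝ := f.2.choose

lemma contDiffOn_extension (f : smoothFunctions S) : ContDiffOn ℝ ∞ (extension f) S :=
  f.2.choose_spec.1

lemma extension_apply (f : smoothFunctions S) (z : S) : extension f z = eval z f :=
  f.2.choose_spec.2 z

lemma differentiableWithinAt_of_eq {f : smoothFunctions S} {F : E → ℝ}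
    (hF : ∀ z : S, F z = eval z f) (z : S) : DifferentiableWithinAt ℝ F S z :=
  ((contDiffOn_extension f).differentiableOn (by simp) z z.2).congr
    (fun y hy => (hF ⟨y, hy⟩).trans (extension_apply f ⟨y, hy⟩).symm)
    ((hF z).trans (extension_apply f z).symm)

lemma fderivWithin_eq {f : smoothFunctions S} {F : E → ℝ}
    (hF : ∀ z : S, F z = eval z f) (z : S) :
    fderivWithin ℝ (extension f) S z = fderivWithin ℝ F S z :=
  fderivWithin_congr (fun y hy => (extension_apply f ⟨y, hy⟩).trans (hF ⟨y, hy⟩).symm)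
    ((extension_apply f z).trans (hF z).symm)

/-- The derivative within `S` in the direction `v`, as a derivation of the smooth functions on
`S`. -/
noncomputable def dirDeriv (hS : UniqueDiffOn ℝ S) (v : E) :
    Derivation ℝ (smoothFunctions S) (smoothFunctions S) :=
  Derivation.mk'
    { toFun := fun f => mk (fun z => fderivWithin ℝ (extension f) S z v)
        (((contDiffOn_extension f).fderivWithin hS (by simp)).clm_apply contDiffOn_const)
      map_add' := fun f f' => ext_eval fun z => by
        have h := fderivWithin_eq (f := f + f') (F := fun y => extension f y + extension f' y)
          (fun y => by simp [extension_apply]) z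
        have d := differentiableWithinAt_of_eq (extension_apply f) z
        have d' := differentiableWithinAt_of_eq (extension_apply f') z
        simp only [map_add, eval_mk, h, fderivWithin_fun_add (hS z z.2) d d']
        rfl
      map_smul' := fun r f => ext_eval fun z => by
        have h := fderivWithin_eq (f := r • f) (F := fun y => r • extension f y)
          (fun y => by simp [extension_apply]) z
        have d := differentiableWithinAt_of_eq (extension_apply f) z
        simp only [map_smul, eval_mk, h, fderivWithin_fun_const_smul (hS z z.2) d]
        rfl }
    fun f f' => ext_eval fun z => by
      have h := fderivWithin_eq (f := f * f') (F := fun y => extension f y * extension f' y)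
        (fun y => by simp [extension_apply]) z
      have d := differentiableWithinAt_of_eq (extension_apply f) z
      have d' := differentiableWithinAt_of_eq (extension_apply f') z
      change fderivWithin ℝ (extension (f * f')) S z v
        = eval z f * fderivWithin ℝ (extension f') S z v
          + eval z f' * fderivWithin ℝ (extension f) S z v
      rw [h, fderivWithin_fun_mul (hS z z.2) d d', extension_apply, extension_apply]
      rfl

lemma eval_dirDeriv (hS : UniqueDiffOn ℝ S) (v : E) {f : smoothFunctions S} {F : E → ℝ}
    (hF : ∀ z : S, F z = eval z f) (z : S) :
    eval z (dirDeriv hS v f) = fderivWithin ℝ F S z v := by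
  rw [← fderivWithin_eq hF]; rfl

lemma dirDeriv_comm (hS : UniqueDiffOn ℝ S) (hcl : S ⊆ closure (interior S)) (v w : E)
    (f : smoothFunctions S) :
    dirDeriv hS v (dirDeriv hS w f) = dirDeriv hS w (dirDeriv hS v f) := by
  refine ext_eval fun z => ?_
  have key : ∀ v w, eval z (dirDeriv hS v (dirDeriv hS w f))
      = fderivWithin ℝ (fderivWithin ℝ (extension f) S) S z v w := fun v w => by
    rw [eval_dirDeriv hS v (F := fun y => fderivWithin ℝ (extension f) S y w)
      (fun y => (eval_dirDeriv hS w (extension_apply f) y).symm)]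
    have d : DifferentiableWithinAt ℝ (fderivWithin ℝ (extension f) S) S z :=
      ((contDiffOn_extension f).fderivWithin hS (m := ∞) (by simp)).differentiableOn (by simp) z z.2
    rw [fderivWithin_clm_apply (hS z z.2) d (differentiableWithinAt_const w)]
    simp
  rw [key, key]
  exact ((contDiffOn_extension f z z.2).isSymmSndFDerivWithinAt
    (by rw [minSmoothness_of_isRCLikeNormedField]
        exact WithTop.coe_le_coe.2 (le_top : (2 : ℕ∞) ≤ ⊤)) hS (hcl z.2) z.2) v w

end smoothFunctions

end SmoothFunctions

/-! ### Linear algebra: from `Ric ∧ Ric = B ∧ g` to the eigenvalues -/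

section Diagonal

variable {n : ℕ}

lemma sum_mul_mul_eq (X Y : Matrix (Fin n) (Fin n) ℝ) (u v w z : Fin n → ℝ) :
    ∑ i, ∑ j, ∑ k, ∑ l, u i * v j * w k * z l * (X i k * Y j l)
      = (u ⬝ᵥ X *ᵥ w) * (v ⬝ᵥ Y *ᵥ z) := by
  have h : ∀ (X : Matrix (Fin n) (Fin n) ℝ) (u w : Fin n → ℝ),
      u ⬝ᵥ X *ᵥ w = ∑ i, ∑ k, u i * X i k * w k := fun X u w => by
    simp only [dotProduct, Matrix.mulVec, Finset.mul_sum, mul_assoc]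
  rw [h, h, Finset.sum_mul_sum]
  refine Finset.sum_congr rfl fun i _ => Finset.sum_congr rfl fun j _ => ?_
  rw [Finset.sum_mul_sum]
  exact Finset.sum_congr rfl fun i _ => Finset.sum_congr rfl fun j _ => by ring

lemma sum_mul_mul_eq_swap (X Y : Matrix (Fin n) (Fin n) ℝ) (u v w z : Fin n → ℝ) :
    ∑ i, ∑ j, ∑ k, ∑ l, u i * v j * w k * z l * (X i l * Y j k)
      = (u ⬝ᵥ X *ᵥ z) * (v ⬝ᵥ Y *ᵥ w) := by
  rw [← sum_mul_mul_eq]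
  refine Finset.sum_congr rfl fun i _ => Finset.sum_congr rfl fun j _ => ?_
  rw [Finset.sum_comm]
  exact Finset.sum_congr rfl fun i _ => Finset.sum_congr rfl fun j _ => by ring

lemma exists_orthogonal_diagonal {S : Matrix (Fin n) (Fin n) ℝ} (hS : S.IsHermitian) :
    ∃ U : Matrix (Fin n) (Fin n) ℝ, Uᵀ * U = 1 ∧ Uᵀ * S * U = diagonal hS.eigenvalues := by
  refine ⟨hS.eigenvectorUnitary, ?_, ?_⟩
  · have := (Matrix.mem_unitaryGroup_iff').mp hS.eigenvectorUnitary.2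
    rwa [star_eq_conjTranspose, conjTranspose_eq_transpose_of_trivial] at this
  · have := hS.conjStarAlgAut_star_eigenvectorUnitary
    simpa [Unitary.conjStarAlgAut_apply, star_eq_conjTranspose,
      conjTranspose_eq_transpose_of_trivial, Function.comp_def] using this

/-- Simultaneous diagonalisation: the columns of `P` are a `G`-orthonormal basis that diagonalises
`S`. -/
lemma exists_congr_diagonal {G S : Matrix (Fin n) (Fin n) ℝ} (hG : G.PosDef) (hS : Sᵀ = S) :
    ∃ (P : Matrix (Fin n) (Fin n) ℝ) (d : Fin n → ℝ), Pᵀ * G * P = 1 ∧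
      Pᵀ * S * P = diagonal d := by
  obtain ⟨U, hU, hUG⟩ := exists_orthogonal_diagonal hG.1
  set e := hG.1.eigenvalues with he
  set E : Matrix (Fin n) (Fin n) ℝ := diagonal fun i => (√(e i))⁻¹ with hE
  have hEt : Eᵀ = E := diagonal_transpose _
  have h1 : (U * E)ᵀ * G * (U * E) = 1 := by
    calc (U * E)ᵀ * G * (U * E) = E * (Uᵀ * G * U) * E := by
          rw [transpose_mul, hEt]; noncomm_ring
      _ = 1 := by
          rw [hUG, hE, diagonal_mul_diagonal, diagonal_mul_diagonal, ← diagonal_one]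
          congr 1; ext i
          have hp : 0 < e i := hG.eigenvalues_pos i
          have := Real.sqrt_pos.mpr hp
          field_simp
          rw [Real.sq_sqrt hp.le]
  have hS' : ((U * E)ᵀ * S * (U * E)).IsHermitian := by
    rw [Matrix.IsHermitian, conjTranspose_eq_transpose_of_trivial]
    simp only [transpose_mul, transpose_transpose, hS, mul_assoc]
  obtain ⟨V, hV, hVS⟩ := exists_orthogonal_diagonal hS'
  refine ⟨U * E * V, hS'.eigenvalues, ?_, ?_⟩
  · calc (U * E * V)ᵀ * G * (U * E * V) = Vᵀ * ((U * E)ᵀ * G * (U * E)) * V := by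
          rw [transpose_mul]; noncomm_ring
      _ = 1 := by rw [h1, mul_one, hV]
  · rw [← hVS, transpose_mul]; noncomm_ring

/-- A matrix similar to `diagonal d` has the eigenspace dimensions of `diagonal d`. -/
lemma finrank_eigenspace_conj {P T : Matrix (Fin n) (Fin n) ℝ} {d : Fin n → ℝ}
    (hP : IsUnit P.det) (hT : T * P = P * diagonal d) (μ : ℝ) :
    Module.finrank ℝ (Module.End.eigenspace (Matrix.toLin' T) μ)
      = Fintype.card {i // d i = μ} := by
  have h1 : Module.End.eigenspace (Matrix.toLin' T) μ = LinearMap.ker (T - μ • 1).mulVecLin := by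
    rw [Module.End.eigenspace_def]
    congr 1
    ext v
    simp
  have h2 : (T - μ • (1 : Matrix (Fin n) (Fin n) ℝ)).rank = Fintype.card {i // d i - μ ≠ 0} := by
    rw [← rank_mul_eq_left_of_isUnit_det P _ hP]
    have : (T - μ • (1 : Matrix (Fin n) (Fin n) ℝ)) * P = P * diagonal fun i => d i - μ := by
      rw [sub_mul, hT, ← diagonal_sub, mul_sub, ← smul_one_eq_diagonal, mul_smul_comm,
        smul_mul_assoc, one_mul, mul_one]
    rw [this, rank_mul_eq_right_of_isUnit_det P _ hP, rank_diagonal]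
  have h3 := LinearMap.finrank_range_add_finrank_ker (T - μ • 1).mulVecLin
  rw [h1]
  have h4 := Fintype.card_subtype_compl fun i => d i = μ
  have h5 := Fintype.card_subtype_le fun i => d i = μ
  simp only [sub_ne_zero] at h2
  simp only [Module.finrank_fin_fun, Fintype.card_fin] at h3 h4 h5
  rw [Matrix.rank] at h2
  simp only [ne_eq] at h2
  omega

/-- If `(d i - d l) * (d j - d k) = 0` for distinct indices, then at most one of at least four
numbers is different from the others: once `d i ≠ d l`, all `d j` with `j ≠ i, l` coincide, and
comparing `i` and `l` with two of these leaves only one exceptional index. -/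
lemma eigenvalue_dichotomy (hn : 4 ≤ n) (d : Fin n → ℝ)
    (h : ∀ i j k l, i ≠ j → i ≠ k → i ≠ l → j ≠ k → j ≠ l → k ≠ l →
      (d i - d l) * (d j - d k) = 0) :
    (∃ c, ∀ i, d i = c) ∨ ∃ i₀, ∃ a, a ≠ d i₀ ∧ ∀ i, i ≠ i₀ → d i = a := by
  have hex : ∀ s : Finset (Fin n), s.card < 4 → ∃ i, i ∉ s := fun s hs => by
    by_contra! hc
    have := Finset.card_le_card (Finset.subset_iff.mpr fun x (_ : x ∈ Finset.univ) => hc x)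
    simp at this; omega
  by_cases hall : ∀ i j, d i = d j
  · exact Or.inl ⟨d ⟨0, by omega⟩, fun i => hall _ _⟩
  push Not at hall
  obtain ⟨i, l, hil⟩ := hall
  have hne : i ≠ l := fun h => hil (h ▸ rfl)
  have hrest : ∀ j k, j ≠ i → j ≠ l → k ≠ i → k ≠ l → d j = d k := fun j k h1 h2 h3 h4 => by
    by_cases hjk : j = k
    · rw [hjk]
    have := h i j k l h1.symm h3.symm hne hjk h2 h4
    exact sub_eq_zero.mp ((mul_eq_zero.mp this).resolve_left (sub_ne_zero.mpr hil))
  obtain ⟨j, hj⟩ := hex {i, l} (Finset.card_le_two.trans_lt (by norm_num))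
  obtain ⟨k, hk⟩ := hex {i, l, j} (Finset.card_le_three.trans_lt (by norm_num))
  simp only [Finset.mem_insert, Finset.mem_singleton, not_or] at hj hk
  have hjk := hrest j k hj.1 hj.2 hk.1 hk.2.1
  have key := h i l k j hne (Ne.symm hk.1) (Ne.symm hj.1) (Ne.symm hk.2.1) (Ne.symm hj.2) hk.2.2
  rcases mul_eq_zero.mp key with h0 | h0
  · refine Or.inr ⟨l, d j, by rw [← sub_eq_zero.mp h0]; exact hil, fun x hx => ?_⟩
    by_cases hxi : x = i
    · rw [hxi]; exact sub_eq_zero.mp h0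
    · exact hrest x j hxi hx hj.1 hj.2
  · refine Or.inr ⟨i, d k, by rw [← sub_eq_zero.mp h0]; exact hil.symm, fun x hx => ?_⟩
    by_cases hxl : x = l
    · rw [hxl]; exact sub_eq_zero.mp h0
    · exact hrest x k hx hxl hk.1 hk.2.1

/-- A symmetric `S` with `S ∧ S = B ∧ G` is a multiple of the inner product `G`, or its endomorphism
`G⁻¹ * S` has exactly two eigenvalues, one of them simple. -/
theorem ricci_dichotomy (hn : 4 ≤ n) {G S B : Matrix (Fin n) (Fin n) ℝ} (hG : G.PosDef)
    (hS : Sᵀ = S) (h : ∀ i j k l, S i k * S j l - S i l * S j k = LeviCivita.kn B G i j k l) :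
    (∃ c : ℝ, ∀ i j, S i j = c * G i j) ∨
      ∃ a b : ℝ, a ≠ b ∧
        Module.finrank ℝ (Module.End.eigenspace (Matrix.toLin' (G⁻¹ * S)) a) = n - 1 ∧
        Module.finrank ℝ (Module.End.eigenspace (Matrix.toLin' (G⁻¹ * S)) b) = 1 := by
  obtain ⟨P, d, hPG, hPS⟩ := exists_congr_diagonal hG hS
  have hP : IsUnit P.det := by
    have := congrArg Matrix.det hPG
    rw [det_mul, det_one] at this
    exact IsUnit.of_mul_eq_one_right _ this
  have hQ : ∀ (X : Matrix (Fin n) (Fin n) ℝ) a b,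
      P.col a ⬝ᵥ X *ᵥ P.col b = (Pᵀ * X * P) a b := fun X a b => by
    rw [dotProduct_mulVec]
    rfl
  -- The hypothesis evaluated on two different vectors of the orthonormal eigenbasis.
  have hd : ∀ a b, a ≠ b → d a * d b = (Pᵀ * B * P) a a + (Pᵀ * B * P) b b := fun a b hab => by
    have h1 : ∑ i, ∑ j, ∑ k, ∑ l, P.col a i * P.col b j * P.col a k * P.col b l *
          (S i k * S j l - S i l * S j k)
        = ∑ i, ∑ j, ∑ k, ∑ l, P.col a i * P.col b j * P.col a k * P.col b l *
          (B i k * G j l + G i k * B j l - B i l * G j k - G i l * B j k) := by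
      refine Finset.sum_congr rfl fun i _ => Finset.sum_congr rfl fun j _ =>
        Finset.sum_congr rfl fun k _ => Finset.sum_congr rfl fun l _ => ?_
      rw [h, LeviCivita.kn]; ring
    simp only [mul_sub, mul_add, Finset.sum_add_distrib, Finset.sum_sub_distrib, sum_mul_mul_eq,
      sum_mul_mul_eq_swap, hQ, hPG, hPS, diagonal_apply_eq, diagonal_apply_ne _ hab,
      diagonal_apply_ne _ hab.symm, one_apply_eq, one_apply_ne hab, one_apply_ne hab.symm] at h1
    linear_combination h1
  have hr : P * (Pᵀ * G) = 1 := mul_eq_one_comm.mp hPG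
  have hSP : S * P = G * P * diagonal d := by
    have : G * P * Pᵀ = 1 := mul_eq_one_comm.mp (by rw [← mul_assoc, hPG])
    rw [← hPS, mul_assoc Pᵀ, ← mul_assoc (G * P), this, one_mul]
  have hT : G⁻¹ * S * P = P * diagonal d := by
    rw [mul_assoc, hSP, mul_assoc, nonsing_inv_mul_cancel_left _ _
      ((isUnit_iff_isUnit_det _).mp hG.isUnit)]
  rcases eigenvalue_dichotomy hn d (fun i j k l h1 h2 h3 h4 h5 h6 => by
    linear_combination hd i j h1 + hd k l h6 - hd i k h2 - hd j l h5) with ⟨c, hc⟩ | ⟨i₀, a, ha, hi⟩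
  · refine Or.inl ⟨c, fun i j => ?_⟩
    have h1 : diagonal d = c • (1 : Matrix (Fin n) (Fin n) ℝ) := by
      rw [smul_one_eq_diagonal]; exact congrArg _ (funext hc)
    have h2 : S = c • G := by
      rw [← mul_one S, ← hr, ← mul_assoc, hSP, h1, mul_smul_comm, mul_one, smul_mul_assoc,
        mul_assoc, hr, mul_one]
    rw [h2]; rfl
  · refine Or.inr ⟨a, d i₀, ha, ?_, ?_⟩
    · rw [finrank_eigenspace_conj hP hT, Fintype.card_congr (Equiv.subtypeEquivRight
        (q := fun i => ¬ i = i₀) fun i => ⟨fun h h' => ha (h' ▸ h.symm), hi i⟩),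
        Fintype.card_subtype_compl, Fintype.card_subtype_eq, Fintype.card_fin]
    · rw [finrank_eigenspace_conj hP hT, Fintype.card_congr (Equiv.subtypeEquivRight
        (q := fun i => i = i₀) fun i => ⟨fun h => by
          by_contra h'
          exact ha ((hi i h').symm.trans h), fun h => by rw [h]⟩), Fintype.card_subtype_eq]

end Diagonal

/-! ### Curvature in coordinates as evaluation of functions on space-time -/

section Coordinates

variable {n : ℕ} {J : Set ℝ} {U : Set (EuclideanSpace ℝ (Fin n))}

open smoothFunctions LeviCivita

/-- At a fixed time, the spatial derivative within `J × U` is the partial derivative in the open set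
`U`. -/
lemma eval_dirDeriv_space (hS : UniqueDiffOn ℝ (J ×ˢ U)) (hU : IsOpen U) (i : Fin n)
    {f : smoothFunctions (J ×ˢ U)} {F : ℝ → EuclideanSpace ℝ (Fin n) → ℝ}
    (hF : ∀ z : ↥(J ×ˢ U), F z.1.1 z.1.2 = eval z f) (z : ↥(J ×ˢ U)) :
    eval z (dirDeriv hS (0, EuclideanSpace.single i 1) f)
      = LocalCoord.pderiv i (F z.1.1) z.1.2 := by
  have d := differentiableWithinAt_of_eq (F := fun z => F z.1 z.2) hF z
  rw [eval_dirDeriv hS _ (F := fun z => F z.1 z.2) hF]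
  have h1 : HasFDerivWithinAt (fun y : EuclideanSpace ℝ (Fin n) => ((z.1.1, y) : ℝ × _))
      (ContinuousLinearMap.inr ℝ ℝ (EuclideanSpace ℝ (Fin n))) U z.1.2 :=
    (hasFDerivAt_prodMk_right z.1.1 z.1.2).hasFDerivWithinAt
  have h2 := (HasFDerivWithinAt.comp (f := fun y => ((z.1.1, y) : ℝ × EuclideanSpace ℝ (Fin n)))
    z.1.2 d.hasFDerivWithinAt h1 fun y hy => ⟨z.2.1, hy⟩).hasFDerivAt (hU.mem_nhds z.2.2)
  rw [LocalCoord.pderiv, show F z.1.1 = (fun z => F z.1 z.2) ∘ fun y => (z.1.1, y) from rfl,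
    h2.fderiv]
  rfl

/-- At a fixed point, the time derivative within `J × U` is the, possibly one-sided, derivative
within `J`. -/
lemma hasDerivWithinAt_time (hS : UniqueDiffOn ℝ (J ×ˢ U))
    {f : smoothFunctions (J ×ˢ U)} {F : ℝ → EuclideanSpace ℝ (Fin n) → ℝ}
    (hF : ∀ z : ↥(J ×ˢ U), F z.1.1 z.1.2 = eval z f) (z : ↥(J ×ˢ U)) :
    HasDerivWithinAt (fun s => F s z.1.2) (eval z (dirDeriv hS (1, 0) f)) J z.1.1 := by
  have d := differentiableWithinAt_of_eq (F := fun z => F z.1 z.2) hF z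
  rw [eval_dirDeriv hS _ (F := fun z => F z.1 z.2) hF]
  have h1 : HasFDerivWithinAt (fun s : ℝ => ((s, z.1.2) : ℝ × EuclideanSpace ℝ (Fin n)))
      (ContinuousLinearMap.inl ℝ ℝ (EuclideanSpace ℝ (Fin n))) J z.1.1 :=
    (hasFDerivAt_prodMk_left z.1.1 z.1.2).hasFDerivWithinAt
  exact (HasFDerivWithinAt.comp (f := fun s => ((s, z.1.2) : ℝ × EuclideanSpace ℝ (Fin n)))
    z.1.1 d.hasFDerivWithinAt h1 fun y hy => ⟨hy, z.2.2⟩).hasDerivWithinAt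

lemma contDiffOn_matrix_det {E : Type*} [NormedAddCommGroup E] [NormedSpace ℝ E] {S : Set E}
    {M : E → Matrix (Fin n) (Fin n) ℝ} (hM : ∀ i j, ContDiffOn ℝ ∞ (fun z => M z i j) S) :
    ContDiffOn ℝ ∞ (fun z => (M z).det) S := by
  simp only [Matrix.det_apply]
  exact ContDiffOn.sum fun σ _ => (contDiffOn_prod fun i _ => hM _ _).const_smul _

lemma contDiffOn_matrix_inv {E : Type*} [NormedAddCommGroup E] [NormedSpace ℝ E] {S : Set E}
    {M : E → Matrix (Fin n) (Fin n) ℝ} (hM : ∀ i j, ContDiffOn ℝ ∞ (fun z => M z i j) S)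
    (hdet : ∀ z ∈ S, (M z).det ≠ 0) (i j : Fin n) :
    ContDiffOn ℝ ∞ (fun z => (M z)⁻¹ i j) S := by
  simp only [Matrix.inv_def, Ring.inverse_eq_inv', Matrix.smul_apply, smul_eq_mul,
    Matrix.adjugate_apply]
  refine ((contDiffOn_matrix_det hM).inv hdet).mul (contDiffOn_matrix_det fun a b => ?_)
  simp only [Matrix.updateRow_apply]
  split_ifs
  · exact contDiffOn_const
  · exact hM a b

section Eval

variable (hS : UniqueDiffOn ℝ (J ×ˢ U))
  {G : ℝ → EuclideanSpace ℝ (Fin n) → Matrix (Fin n) (Fin n) ℝ}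
  {g H : Matrix (Fin n) (Fin n) (smoothFunctions (J ×ˢ U))}

/-- The partial derivative in the `i`-th coordinate direction, on functions on `J × U`. -/
noncomputable def spaceDeriv (i : Fin n) :
    Derivation ℝ (smoothFunctions (J ×ˢ U)) (smoothFunctions (J ×ˢ U)) :=
  dirDeriv hS (0, EuclideanSpace.single i 1)

variable (hU : IsOpen U) (hg : ∀ (z : ↥(J ×ˢ U)) i j, eval z (g i j) = G z.1.1 z.1.2 i j)
  (hH : ∀ (z : ↥(J ×ˢ U)) i j, eval z (H i j) = (G z.1.1 z.1.2)⁻¹ i j)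
include hU hg hH

lemma eval_christoffelMatrix (i l k : Fin n) (z : ↥(J ×ˢ U)) :
    eval z (christoffelMatrix (spaceDeriv hS) g H i l k)
      = LocalCoord.christoffel (G z.1.1) l i k z.1.2 := by
  have hd : ∀ m a b, eval z (spaceDeriv hS m (g a b))
      = LocalCoord.pderiv m (fun y => G z.1.1 y a b) z.1.2 := fun m a b =>
    eval_dirDeriv_space hS hU m (F := fun t y => G t y a b) (fun z => (hg z a b).symm) z
  simp only [christoffelMatrix, Matrix.of_apply, map_smul, map_sum, map_mul, map_add, map_sub, hd,
    hH, LocalCoord.christoffel, smul_eq_mul]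

lemma eval_curvature (i j l k : Fin n) (z : ↥(J ×ˢ U)) :
    eval z (curvature (spaceDeriv hS) (christoffelMatrix (spaceDeriv hS) g H) i j l k)
      = LocalCoord.riemUp (G z.1.1) l i j k z.1.2 := by
  have hc := eval_christoffelMatrix hS hU hg hH
  have hd : ∀ m i l k, eval z (spaceDeriv hS m (christoffelMatrix (spaceDeriv hS) g H i l k))
      = LocalCoord.pderiv m (LocalCoord.christoffel (G z.1.1) l i k) z.1.2 := fun m i l k =>
    eval_dirDeriv_space hS hU m (F := fun t => LocalCoord.christoffel (G t) l i k)
      (fun z => (hc i l k z).symm) z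
  simp only [curvature, Matrix.sub_apply, Matrix.add_apply, dm_apply, Matrix.mul_apply, map_sub,
    map_add, map_sum, map_mul, hd, hc, LocalCoord.riemUp, Finset.sum_sub_distrib, mul_comm]
  ring

lemma eval_riem (i j k l : Fin n) (z : ↥(J ×ˢ U)) :
    eval z ((g * curvature (spaceDeriv hS) (christoffelMatrix (spaceDeriv hS) g H) i j) l k)
      = LocalCoord.riem (G z.1.1) i j k l z.1.2 := by
  simp only [Matrix.mul_apply, map_sum, map_mul, eval_curvature hS hU hg hH, hg, LocalCoord.riem]

end Eval

end Coordinates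

/-! ### Ricci flows with vanishing Weyl tensor in a chart -/

section CoordinateFlow

variable {n : ℕ} {J : Set ℝ} {U : Set (EuclideanSpace ℝ (Fin n))}

open smoothFunctions LeviCivita

/-- A Ricci flow in coordinates with vanishing Weyl tensor has `Ric ∧ Ric = B ∧ g` for some `B`, at
every time and point. The symmetry of `Ric` is read off from the flow equation. -/
theorem exists_ricci_kn (hn : 4 ≤ n) (hJ : UniqueDiffOn ℝ J) (hJc : J ⊆ closure (interior J))
    (hU : IsOpen U) {G : ℝ → EuclideanSpace ℝ (Fin n) → Matrix (Fin n) (Fin n) ℝ}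
    (hG : ∀ i j, ContDiffOn ℝ ∞ (fun z : ℝ × EuclideanSpace ℝ (Fin n) => G z.1 z.2 i j) (J ×ˢ U))
    (hGs : ∀ t x, (G t x)ᵀ = G t x) (hdet : ∀ t ∈ J, ∀ x ∈ U, (G t x).det ≠ 0)
    (hflow : ∀ i j, ∀ t ∈ J, ∀ x ∈ U,
      HasDerivWithinAt (fun s => G s x i j) (-2 * LocalCoord.ricci (G t) i j x) J t)
    (hW : ∀ t ∈ J, ∀ x ∈ U, ∀ i j k l, LocalCoord.weyl (G t) i j k l x = 0)
    {t : ℝ} (ht : t ∈ J) {x : EuclideanSpace ℝ (Fin n)} (hx : x ∈ U) :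
    (∀ i j, LocalCoord.ricci (G t) i j x = LocalCoord.ricci (G t) j i x) ∧
    ∃ B : Matrix (Fin n) (Fin n) ℝ, ∀ i j k l,
      LocalCoord.ricci (G t) i k x * LocalCoord.ricci (G t) j l x
        - LocalCoord.ricci (G t) i l x * LocalCoord.ricci (G t) j k x = kn B (G t x) i j k l := by
  have hS : UniqueDiffOn ℝ (J ×ˢ U) := hJ.prod hU.uniqueDiffOn
  have hScl : J ×ˢ U ⊆ closure (interior (J ×ˢ U)) := by
    rw [interior_prod_eq, closure_prod_eq, hU.interior_eq]
    exact Set.prod_mono hJc subset_closure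
  set D := spaceDeriv hS
  set τ := dirDeriv hS (1, 0)
  set g : Matrix (Fin n) (Fin n) (smoothFunctions (J ×ˢ U)) :=
    Matrix.of fun i j => mk _ (hG i j)
  set H : Matrix (Fin n) (Fin n) (smoothFunctions (J ×ˢ U)) :=
    Matrix.of fun i j => mk _ (contDiffOn_matrix_inv hG (fun z hz => hdet _ hz.1 _ hz.2) i j)
  have eg : ∀ (z : ↥(J ×ˢ U)) i j, eval z (g i j) = G z.1.1 z.1.2 i j := fun _ _ _ => rfl
  have eH : ∀ (z : ↥(J ×ˢ U)) i j, eval z (H i j) = (G z.1.1 z.1.2)⁻¹ i j := fun _ _ _ => rfl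
  have hgs : gᵀ = g := by
    ext1 i j
    exact ext_eval fun z => congrFun (congrFun (hGs z.1.1 z.1.2) i) j
  have hgH : g * H = 1 := by
    ext1 i j
    refine ext_eval fun z => ?_
    have h := congrFun (congrFun (mul_nonsing_inv (G z.1.1 z.1.2)
      (hdet _ z.2.1 _ z.2.2).isUnit) i) j
    rw [Matrix.mul_apply, Matrix.one_apply] at h
    rw [Matrix.mul_apply, Matrix.one_apply, map_sum]
    simp only [map_mul, eg, eH, h]
    split_ifs <;> simp
  set Γ := christoffelMatrix D g H
  set ric : Matrix (Fin n) (Fin n) (smoothFunctions (J ×ˢ U)) :=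
    Matrix.of fun i k => ∑ j, ∑ l, H j l * (g * curvature D Γ i j) l k with hric
  have eRm : ∀ (z : ↥(J ×ˢ U)) i j k l, eval z ((g * curvature D Γ i j) l k)
      = LocalCoord.riem (G z.1.1) i j k l z.1.2 := fun z i j k l => eval_riem hS hU eg eH i j k l z
  have eR : ∀ (z : ↥(J ×ˢ U)) i k, eval z (ric i k) = LocalCoord.ricci (G z.1.1) i k z.1.2 :=
    fun z i k => by
      simp only [hric, Matrix.of_apply, map_sum, map_mul, eRm, eH, LocalCoord.ricci]
  set sc : smoothFunctions (J ×ˢ U) := ∑ i, ∑ k, H i k * ric i k with hsc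
  have eS : ∀ z : ↥(J ×ˢ U), eval z sc = LocalCoord.scalar (G z.1.1) z.1.2 := fun z => by
    simp only [hsc, map_sum, map_mul, eR, eH, LocalCoord.scalar]
  have hn' : (4 : ℝ) ≤ n := by exact_mod_cast hn
  have h1 : (n : ℝ) - 1 ≠ 0 := by linarith
  have h2 : (n : ℝ) - 2 ≠ 0 := by linarith
  -- The Schouten tensor `A`, with `Ric = (n - 2) A + s g`.
  set s : smoothFunctions (J ×ˢ U) := (1 / (2 * ((n : ℝ) - 1))) • sc with hs
  set A : Matrix (Fin n) (Fin n) (smoothFunctions (J ×ˢ U)) :=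
    (1 / ((n : ℝ) - 2)) • (ric - s • g) with hA
  have hτg : ∀ i j, τ (g i j) = (-2 : ℝ) • ric i j := fun i j => ext_eval fun z => by
    rw [map_smul, eR]
    exact (hJ z.1.1 z.2.1).eq_deriv _
      (hasDerivWithinAt_time hS (F := fun t x => G t x i j) (fun z => (eg z i j).symm) z)
      (hflow i j _ z.2.1 _ z.2.2)
  have hrs : ricᵀ = ric := by
    ext1 i j
    have h : (-2 : ℝ) • ric j i = (-2 : ℝ) • ric i j := by
      rw [← hτg, ← hτg, ← congrFun (congrFun hgs i) j, Matrix.transpose_apply]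
    exact smul_right_injective _ (by norm_num : (-2 : ℝ) ≠ 0) h
  have hAs : Aᵀ = A := by
    rw [hA, Matrix.transpose_smul, Matrix.transpose_sub, Matrix.transpose_smul, hrs, hgs]
  have hcA : algebraMap ℝ (smoothFunctions (J ×ˢ U)) ((n : ℝ) - 2) • A + s • g = ric := by
    rw [algebraMap_smul, hA, smul_smul, mul_one_div_cancel h2, one_smul, sub_add_cancel]
  have eA : ∀ (z : ↥(J ×ˢ U)) i j, eval z (A i j) = 1 / ((n : ℝ) - 2)
      * (LocalCoord.ricci (G z.1.1) i j z.1.2 - 1 / (2 * ((n : ℝ) - 1))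
        * LocalCoord.scalar (G z.1.1) z.1.2 * G z.1.1 z.1.2 i j) := fun z i j => by
    simp only [hA, hs, Matrix.smul_apply, Matrix.sub_apply, map_smul, map_sub, smul_eq_mul,
      map_mul, eR, eS, eg]
  obtain ⟨B, hB⟩ := exists_kn_eq (D := D) (Γ := Γ) (g := g) (τ := τ) (H := H) (A := A)
    (c := (n : ℝ) - 2) (s := s) (by simpa using hn)
    (fun i j f => dirDeriv_comm hS hScl _ _ f) (fun i f => dirDeriv_comm hS hScl _ _ f)
    hgs hAs (fun i k l => christoffelMatrix_symm hgs i k l) (fun i => dm_metric_eq hgs hgH i) hgH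
    (fun i j k l => ext_eval fun z => by
      have h := hW _ z.2.1 _ z.2.2 i j k l
      rw [LocalCoord.weyl] at h
      simp only [eRm, kn, map_sub, map_add, map_mul, eA, eg]
      field_simp at h ⊢
      linear_combination 2 * h)
    (by
      rw [hcA]
      ext1 i j
      rw [dm_apply, hτg, Matrix.smul_apply, smul_eq_mul, Algebra.smul_def, map_neg, map_ofNat])
  set z : ↥(J ×ˢ U) := ⟨(t, x), ht, hx⟩
  refine ⟨fun i j => ?_, (((n : ℝ) - 2) / 2) • (Matrix.of fun i j => eval z (B i j))
    + eval z s • (Matrix.of fun i j => LocalCoord.ricci (G t) i j x)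
    - (eval z s ^ 2 / 2) • G t x, fun i j k l => ?_⟩
  · rw [← eR z i j, ← eR z j i, ← congrFun (congrFun hrs i) j, Matrix.transpose_apply]
  · -- Expanding `Ric ∧ Ric` with `Ric = (n - 2) A + s g`, only `A ∧ A` needs the identity for `A`.
    have hr : ∀ i j, LocalCoord.ricci (G t) i j x
        = ((n : ℝ) - 2) * eval z (A i j) + eval z s * G t x i j := fun i j => by
      rw [← eR z i j, ← hcA, Matrix.add_apply, Matrix.smul_apply, Matrix.smul_apply, map_add,
        smul_eq_mul, smul_eq_mul, map_mul, map_mul, AlgHom.commutes]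
      rfl
    have hBz := congrArg (eval z) (hB i j k l)
    simp only [kn, map_sub, map_add, map_mul, map_ofNat, AlgHom.commutes, eg,
      Algebra.algebraMap_self_apply] at hBz
    simp only [kn, Matrix.sub_apply, Matrix.add_apply, Matrix.smul_apply, Matrix.of_apply,
      smul_eq_mul, hr]
    linear_combination ((n : ℝ) - 2) / 2 * hBz

end CoordinateFlow

section Chart

variable {n : ℕ} {M : Type*} [TopologicalSpace M] [ChartedSpace (EuclideanSpace ℝ (Fin n)) M]

lemma mfderiv_symm_injective {φ : OpenPartialHomeomorph M (EuclideanSpace ℝ (Fin n))}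
    (hφ : φ ∈ IsManifold.maximalAtlas (𝓡 n) ∞ M) {x : EuclideanSpace ℝ (Fin n)}
    (hx : x ∈ φ.target) : Function.Injective (mfderiv (𝓡 n) (𝓡 n) φ.symm x) := by
  have h : φ.MDifferentiable (𝓡 n) (𝓡 n) :=
    ⟨(contMDiffOn_of_mem_maximalAtlas hφ).mdifferentiableOn (by simp),
      (contMDiffOn_symm_of_mem_maximalAtlas hφ).mdifferentiableOn (by simp)⟩
  exact h.symm.mfderiv_injective hx

variable [IsManifold (𝓡 n) ∞ M]

lemma metricCoord_transpose (g : SmoothMetric n M)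
    (φ : OpenPartialHomeomorph M (EuclideanSpace ℝ (Fin n))) (x : EuclideanSpace ℝ (Fin n)) :
    (metricCoord g φ x)ᵀ = metricCoord g φ x := by
  ext i j
  exact g.symm _ _ _

lemma metricCoord_posDef (g : SmoothMetric n M)
    {φ : OpenPartialHomeomorph M (EuclideanSpace ℝ (Fin n))}
    (hφ : φ ∈ IsManifold.maximalAtlas (𝓡 n) ∞ M) {x : EuclideanSpace ℝ (Fin n)}
    (hx : x ∈ φ.target) : (metricCoord g φ x).PosDef := by
  refine Matrix.PosDef.of_dotProduct_mulVec_pos ?_ fun v hv => ?_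
  · rw [Matrix.IsHermitian, conjTranspose_eq_transpose_of_trivial, metricCoord_transpose]
  · set L := mfderiv (𝓡 n) (𝓡 n) φ.symm x
    have hsum : ∑ i, v i • coordVector φ x i = L (WithLp.toLp 2 v) := by
      have : (WithLp.toLp 2 v : EuclideanSpace ℝ (Fin n))
          = ∑ i, v i • EuclideanSpace.single i (1 : ℝ) := by
        ext j; simp [Finset.sum_apply, Pi.single_apply]
      rw [this]
      erw [map_sum]
      exact Finset.sum_congr rfl fun i _ => ((L.map_smul (v i) _).symm)
    have hne : L (WithLp.toLp 2 v) ≠ 0 := fun h0 => hv <| by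
      have := mfderiv_symm_injective hφ hx (h0.trans L.map_zero.symm)
      exact (WithLp.toLp_injective 2) this
    have hpos := g.pos _ _ hne
    rw [← hsum] at hpos
    simp only [map_sum, map_smul, _root_.sum_apply, _root_.smul_apply,
      smul_eq_mul, Finset.mul_sum] at hpos
    simp only [star_trivial, dotProduct, mulVec, Finset.mul_sum]
    refine hpos.trans_eq ?_
    rw [Finset.sum_comm]
    refine Finset.sum_congr rfl fun i _ => Finset.sum_congr rfl fun j _ => ?_
    rw [metricCoord, Matrix.of_apply]; ring

end Chart

/-! ### Conclusion -/

theorem mainTheorem2 {n : ℕ} (hn : 4 ≤ n) {M : Type*} [TopologicalSpace M]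
    [ChartedSpace (EuclideanSpace ℝ (Fin n)) M] [IsManifold (𝓡 n) ∞ M]
    (J : Set ℝ) (g : ℝ → SmoothMetric n M) (hflow : IsRicciFlow J g)
    (hW : ∀ t ∈ J, WeylVanishes (g t)) :
    ∀ t ∈ J, ∀ p : M, ∀ φ ∈ IsManifold.maximalAtlas (𝓡 n) ∞ M, p ∈ φ.source →
      (∃ c : ℝ, ∀ i j : Fin n, LocalCoord.ricci (metricCoord (g t) φ) i j (φ p)
        = c * metricCoord (g t) φ (φ p) i j) ∨
      (∃ a b : ℝ, a ≠ b ∧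
        Module.finrank ℝ
          (Module.End.eigenspace (LocalCoord.ricciEndo (metricCoord (g t) φ) (φ p)) a) = n - 1 ∧
        Module.finrank ℝ
          (Module.End.eigenspace (LocalCoord.ricciEndo (metricCoord (g t) φ) (φ p)) b) = 1) := by
  intro t ht p φ hφ hp
  have hJc : Convex ℝ J := hflow.ordConnected.convex
  -- A nondegenerate interval has interior points, so that derivatives within it are unique.
  have hJi : (interior J).Nonempty := by
    obtain ⟨a, ha, b, hb, hab⟩ := hflow.nontrivial.exists_lt
    refine ((Set.nonempty_Ioo.mpr hab).mono ?_)
    rw [← interior_Icc]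
    exact interior_mono (hflow.ordConnected.out ha hb)
  obtain ⟨hs, B, hB⟩ := exists_ricci_kn hn (uniqueDiffOn_convex hJc hJi)
    (by rw [hJc.closure_interior_eq_closure_of_nonempty_interior hJi]; exact subset_closure)
    φ.open_target (G := fun t => metricCoord (g t) φ) (hflow.smooth φ hφ)
    (fun t x => metricCoord_transpose (g t) φ x)
    (fun t _ x hx => (metricCoord_posDef (g t) hφ hx).det_pos.ne')
    (hflow.evolution φ hφ) (fun t ht x hx => hW t ht φ hφ x hx) ht (φ.map_source hp)
  exact ricci_dichotomy (S := Matrix.of fun j k => LocalCoord.ricci (metricCoord (g t) φ) j k (φ p))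
    hn (metricCoord_posDef (g t) hφ (φ.map_source hp)) (by ext i j; exact hs j i) hB
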